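/- Let $(S,\rho)$ be a compact metric space with diameter $D=\operatorname{diam}(S)$, let $\nu$ be a Borel measure on $S$, and let $\lambda:S\to\mathbb{R}$ be $\nu$-integrable, continuous, and such that $\lambda(\zeta)\ge\lambda_0$ for all $\zeta\in S$, for some constant $\lambda_0>0$. Let $k:\mathbb{R}\to[0,\infty)$ be a symmetric kernel ($k(-x)=k(x)$) which is continuous on $[0,D]$, vanishes on $(D,\infty)$, and satisfies $k(x)>k_0$ for all $x\in[0,D]$, for some constant $k_0>0$. Let $d\in\mathbb{R}$. For $\sigma>0$, a finite set $x\subset S$ and $\zeta\in S$ put $$K_\sigma(\zeta)=\int_S \frac{1}{\sigma^d}\,k\Big(\frac{\rho(\zeta,\xi)}{\sigma}\Big)\,d\nu(\xi),\qquad \hat\lambda_{\sigma}(\zeta;x)=\frac{1}{K_\sigma(\zeta)}\sum_{\xi\in x}\frac{1}{\sigma^d}\,k\Big(\frac{\rho(\zeta,\xi)}{\sigma}\Big).$$ A Poisson process on $S$ with intensity $\lambda$ is a random finite subset $X$ of $S$ such that $N_A=\#(X\cap A)$ is a random variable for every Borel set $A\subset S$, $N_{A_1},\dots,N_{A_n}$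 are independent whenever $A_1,\dots,A_n$ are disjoint Borel sets, and $N_A$ has the Poisson distribution with mean $\int_A\lambda\,d\nu$ for every Borel set $A$. Then for $\nu$-almost every $\zeta\in S$ there is a deterministic sequence $\sigma_m=\sigma_m(\zeta)>0$ with $\sigma_m\to0$ such that, for every sequence $X_1,X_2,\dots$ of independent Poisson processes on $S$ with intensity $\lambda$, defined on a common probability space, $$\lim_{m\to\infty}\Big|\frac1m\sum_{j=1}^m\hat\lambda_{\sigma_m}(\zeta;X_j)-\lambda(\zeta)\Big|=0\quad\text{almost surely.}$$ (Independence of the processes is with respect to the $\sigma$-algebra on finite subsets of $S$ generated by the counts $x\mapsto\#(x\cap A)$, $A$ Borel.) -/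

import Mathlib

open MeasureTheory ProbabilityTheory Filter Topology Set

noncomputable section

namespace PoissonIntensity

variable {S : Type*}

open Classical in
/-- The number of points of the finite configuration `x ⊆ S` lying in `A`. -/
def count (A : Set S) (x : Finset S) : ℕ := (x.filter (fun ξ => ξ ∈ A)).card

/-- The σ-algebra on the space `Finset S` of finite subsets of `S` generated by the counting maps
`x ↦ #(x ∩ A)`, with `A` ranging over the measurable subsets of `S`. -/
abbrev configSpace (S : Type*) [MeasurableSpace S] : MeasurableSpace (Finset S) :=
  ⨆ A : {A : Set S // MeasurableSet A}, MeasurableSpace.comap (count A.1) ⊤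

/-- `X` is a Poisson process on `S` with intensity `lam` with respect to `ν`: the counts are random
variables, counts over disjoint sets are independent, and the count over `A` has the Poisson
distribution with mean `∫ ζ in A, lam ζ ∂ν`. -/
structure IsPoissonProcess [MeasurableSpace S] {Ω : Type*} [MeasurableSpace Ω]
    (ν : Measure S) (lam : S → ℝ) (P : Measure Ω) (X : Ω → Finset S) : Prop where
  measurable_count : ∀ A : Set S, MeasurableSet A → Measurable (fun ω => count A (X ω))
  indep_count : ∀ (n : ℕ) (A : Fin n → Set S), (∀ i, MeasurableSet (A i)) →
    (∀ i j, i ≠ j → Disjoint (A i) (A j)) → iIndepFun (fun i ω => count (A i) (X ω)) P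
  law_count : ∀ A : Set S, MeasurableSet A →
    P.map (fun ω => count A (X ω)) = poissonMeasure (∫ ζ in A, lam ζ ∂ν).toNNReal

/-- A sequence of independent Poisson processes with common intensity `lam`. -/
structure IsPoissonSample [MeasurableSpace S] {Ω : Type*} [MeasurableSpace Ω]
    (ν : Measure S) (lam : S → ℝ) (P : Measure Ω) (X : ℕ → Ω → Finset S) : Prop where
  poisson : ∀ j, IsPoissonProcess ν lam P (X j)
  indep : iIndepFun (m := fun _ : ℕ => configSpace S) X P

/-- The normalization `K_σ(ζ) = ∫ σ^{-d} k(ρ(ζ, ξ) / σ) dν(ξ)`. -/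
def kernelMass [MetricSpace S] [MeasurableSpace S] (ν : Measure S) (k : ℝ → ℝ) (d σ : ℝ)
    (ζ : S) : ℝ :=
  ∫ ξ, 1 / σ ^ d * k (dist ζ ξ / σ) ∂ν

/-- The kernel estimator of the intensity at `ζ` from one configuration `x`. -/
def intensityEstimator [MetricSpace S] [MeasurableSpace S] (ν : Measure S) (k : ℝ → ℝ) (d σ : ℝ)
    (x : Finset S) (ζ : S) : ℝ :=
  1 / kernelMass ν k d σ ζ * ∑ ξ ∈ x, 1 / σ ^ d * k (dist ζ ξ / σ)

/-- The average of the kernel estimators computed from the first `m` configurations of `x`. -/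
def averagedEstimator [MetricSpace S] [MeasurableSpace S] (ν : Measure S) (k : ℝ → ℝ) (d σ : ℝ)
    (m : ℕ) (x : ℕ → Finset S) (ζ : S) : ℝ :=
  1 / (m : ℝ) * ∑ j ∈ Finset.range m, intensityEstimator ν k d σ (x j) ζ

end PoissonIntensity

end

/-!
The averaged estimator at `ζ` is the average over the sample of the linear statistic
`x ↦ ∑ ξ ∈ x, w_σ ξ`, where `w_σ` (`kernelWeight`) is the kernel at scale `σ` normalized to have
`ν`-integral `1`. Since `lam` is integrable and bounded below by a positive constant, `ν` is finite,
and `ν`-almost every `ζ` lies in the topological support of `ν`, where the normalization does not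
vanish (`kernelMass_pos`).

*Bias.* By Campbell's formula (`IsPoissonProcess.integral_sum`) the statistic has mean
`∫ w_σ * lam ∂ν`. The weights `w_σ` live on the closed ball of radius `σ * diam S` around `ζ`, so
this mean tends to `lam ζ` as `σ → 0` by continuity (`tendsto_integral_kernelWeight_mul`).

*Fluctuations.* For fixed `σ` the statistic is at most a constant times the total number of points,
which is Poisson distributed and so has all exponential moments. A Chernoff bound gives a deviation
probability `2 * exp (-δ * m)` for the average of `m` terms (`exists_rate_average_sum`), where `δ`
depends on `σ`, on the tolerance and on the law only, not on the probability space.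

*Bandwidths.* Because the bound decays in `m` for each fixed scale, one can let the scale
`1 / (n + 1)` decrease slowly, `n = N m → ∞`, keeping the deviation probabilities below `1 / m ^ 2`
(`exists_tendsto_atTop_eventually`). Borel–Cantelli then yields almost sure convergence
(`exists_bandwidth`). Uniformity of the rate is what makes the bandwidths deterministic and common
to all samples.
-/

namespace PoissonIntensity

/-! ### Exponential moments and the mean of the Poisson distribution -/

section Poisson

open scoped NNReal Nat

lemma integrable_exp_mul_poissonMeasure (r : ℝ≥0) (c : ℝ) :
    Integrable (fun n : ℕ => Real.exp (c * n)) (poissonMeasure r) := by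
  rw [integrable_poissonMeasure_iff]
  refine ((Real.summable_pow_div_factorial (r * Real.exp c)).mul_left
    (Real.exp (-r))).congr fun n => ?_
  rw [Real.norm_of_nonneg (Real.exp_pos _).le, mul_pow, ← Real.exp_nat_mul, mul_comm c]
  ring

lemma lintegral_natCast_poissonMeasure (r : ℝ≥0) :
    ∫⁻ n : ℕ, (n : ENNReal) ∂(poissonMeasure r) = r := by
  have hint : Integrable (fun n : ℕ => (n : ℝ)) (poissonMeasure r) := by
    refine (integrable_exp_mul_poissonMeasure r 1).mono' (by fun_prop) (ae_of_all _ fun n => ?_)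
    rw [Real.norm_of_nonneg n.cast_nonneg, one_mul]
    linarith [Real.add_one_le_exp (n : ℝ)]
  have h1 := hasSum_integral_poissonMeasure hint
  rw [← hasSum_nat_add_iff' 1] at h1
  have h2 : HasSum (fun n : ℕ => (r : ℝ) * (Real.exp (-r) * r ^ n / (n)!)) (r * 1) :=
    (hasSum_one_poissonMeasure r).mul_left _
  have h3 : (∫ n : ℕ, (n : ℝ) ∂(poissonMeasure r)) = r := by
    have : (fun n : ℕ => (Real.exp (-r) * r ^ (n + 1) / ((n + 1)! : ℝ)) • ((n + 1 : ℕ) : ℝ))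
        = fun n : ℕ => (r : ℝ) * (Real.exp (-r) * r ^ n / (n)!) := by
      ext n
      rw [smul_eq_mul, Nat.factorial_succ]
      push_cast
      field_simp
      ring
    rw [this] at h1
    simpa using h1.unique h2
  have h4 := ofReal_integral_eq_lintegral_ofReal hint (ae_of_all _ fun n => n.cast_nonneg)
  rw [h3] at h4
  simpa using h4.symm

end Poisson

/-! ### A Chernoff bound for averages -/

section Chernoff

variable {Ω : Type*} [MeasurableSpace Ω] {P : Measure Ω}

lemma exp_le_one_add_self_add_sq_mul_exp_abs (x : ℝ) :
    Real.exp x ≤ 1 + x + x ^ 2 * Real.exp |x| := by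
  have h := Complex.norm_exp_sub_sum_le_norm_mul_exp (x : ℂ) 2
  have e : Complex.exp x - ∑ m ∈ Finset.range 2, (x : ℂ) ^ m / m.factorial
      = ((Real.exp x - (1 + x) : ℝ) : ℂ) := by
    simp [Finset.sum_range_succ]
  rw [e, Complex.norm_real, Complex.norm_real, Real.norm_eq_abs, Real.norm_eq_abs, sq_abs] at h
  linarith [le_abs_self (Real.exp x - (1 + x))]

lemma integrable_exp_mul_of_abs_le {Z W : Ω → ℝ} (hZ : Measurable Z) (hZW : ∀ ω, |Z ω| ≤ W ω)
    (hW : Integrable (fun ω => Real.exp (2 * W ω)) P) {t : ℝ} (ht : |t| ≤ 1) :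
    Integrable (fun ω => Real.exp (t * Z ω)) P := by
  refine hW.mono' (by fun_prop) (ae_of_all _ fun ω => ?_)
  rw [Real.norm_of_nonneg (Real.exp_pos _).le, Real.exp_le_exp]
  have h1 : t * Z ω ≤ |t| * |Z ω| := (le_abs_self _).trans (abs_mul _ _).le
  have h2 : |t| * |Z ω| ≤ 1 * |Z ω| := mul_le_mul_of_nonneg_right ht (abs_nonneg _)
  linarith [hZW ω, abs_nonneg (Z ω)]

/-- A centred random variable with an exponential moment is sub-exponential: near `0` its moment
generating function is bounded by a Gaussian one, whose variance proxy depends only on the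
exponential moment of a majorant. -/
lemma mgf_le_exp_mul_sq [IsProbabilityMeasure P] {Z W : Ω → ℝ} (hZ : Measurable Z)
    (hZW : ∀ ω, |Z ω| ≤ W ω) (hW : Integrable (fun ω => Real.exp (2 * W ω)) P)
    (hZint : Integrable Z P) (hZ0 : ∫ ω, Z ω ∂P = 0) {t : ℝ} (ht : |t| ≤ 1) :
    mgf Z P t ≤ Real.exp (2 * (∫ ω, Real.exp (2 * W ω) ∂P) * t ^ 2) := by
  have hpt : ∀ ω, Real.exp (t * Z ω) ≤ 1 + t * Z ω + 2 * t ^ 2 * Real.exp (2 * W ω) := by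
    intro ω
    have h0 := abs_nonneg (Z ω)
    have h1 : |t * Z ω| ≤ W ω := by
      rw [abs_mul]
      nlinarith [hZW ω, abs_nonneg t]
    have h2 : Z ω ^ 2 ≤ 2 * Real.exp (W ω) := by
      have := Real.quadratic_le_exp_of_nonneg (h0.trans (hZW ω))
      have h3 : Z ω ^ 2 ≤ W ω ^ 2 := by
        rw [← sq_abs]
        exact pow_le_pow_left₀ h0 (hZW ω) 2
      linarith [h0.trans (hZW ω)]
    calc Real.exp (t * Z ω) ≤ 1 + t * Z ω + (t * Z ω) ^ 2 * Real.exp |t * Z ω| :=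
          exp_le_one_add_self_add_sq_mul_exp_abs _
      _ ≤ 1 + t * Z ω + t ^ 2 * (2 * Real.exp (W ω)) * Real.exp (W ω) := by
          rw [mul_pow]
          gcongr
      _ = _ := by
          rw [two_mul (W ω), Real.exp_add]
          ring
  have hint : Integrable (fun ω => 1 + t * Z ω) P := (integrable_const _).add (hZint.const_mul t)
  calc mgf Z P t ≤ ∫ ω, (1 + t * Z ω + 2 * t ^ 2 * Real.exp (2 * W ω)) ∂P :=
        integral_mono (integrable_exp_mul_of_abs_le hZ hZW hW ht)
          (hint.add (hW.const_mul _)) hpt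
    _ = 2 * (∫ ω, Real.exp (2 * W ω) ∂P) * t ^ 2 + 1 := by
        rw [integral_add hint (hW.const_mul _), integral_add (integrable_const _)
          (hZint.const_mul t), integral_const_mul, integral_const_mul, hZ0]
        simp
        ring
    _ ≤ _ := Real.add_one_le_exp _

lemma measureReal_le_sum_le_exp [IsProbabilityMeasure P] {Z : ℕ → Ω → ℝ}
    (hind : iIndepFun Z P) (hZ : ∀ j, Measurable (Z j)) {C ε t : ℝ} (ht : 0 ≤ t)
    (hint : ∀ j, Integrable (fun ω => Real.exp (t * Z j ω)) P)
    (hmgf : ∀ j, mgf (Z j) P t ≤ Real.exp (C * t ^ 2)) (m : ℕ) :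
    P.real {ω | m * ε ≤ ∑ j ∈ Finset.range m, Z j ω}
      ≤ Real.exp (-(t * ε - C * t ^ 2) * m) := by
  have h := measure_ge_le_exp_mul_mgf (μ := P) (X := ∑ j ∈ Finset.range m, Z j) (m * ε) ht
    (hind.integrable_exp_mul_sum hZ fun j _ => hint j)
  rw [hind.mgf_sum hZ] at h
  simp only [Finset.sum_apply] at h
  refine h.trans ?_
  have hp : ∏ j ∈ Finset.range m, mgf (Z j) P t ≤ Real.exp (C * t ^ 2) ^ m :=
    (Finset.prod_le_prod (fun _ _ => mgf_nonneg) fun j _ => hmgf j).trans (by simp)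
  calc _ ≤ Real.exp (-t * (m * ε)) * Real.exp (C * t ^ 2) ^ m := by gcongr
    _ = _ := by
      rw [← Real.exp_nat_mul, ← Real.exp_add]
      ring_nf

/-- Two-sided exponential bound for averages of independent variables with Gaussian-type moment
generating functions on `[-1, 1]`; the rate depends only on the proxy `C` and on `ε`. -/
lemma measureReal_le_abs_average_le_exp [IsProbabilityMeasure P] {Z : ℕ → Ω → ℝ}
    (hind : iIndepFun Z P) (hZ : ∀ j, Measurable (Z j)) {C ε : ℝ} (hC : 0 < C) (hε : 0 < ε)
    (hint : ∀ j t, |t| ≤ 1 → Integrable (fun ω => Real.exp (t * Z j ω)) P)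
    (hmgf : ∀ j t, |t| ≤ 1 → mgf (Z j) P t ≤ Real.exp (C * t ^ 2)) (m : ℕ) :
    P.real {ω | ε ≤ |1 / (m : ℝ) * ∑ j ∈ Finset.range m, Z j ω|}
      ≤ 2 * Real.exp (-(min 1 (ε / (2 * C)) * ε / 2) * m) := by
  -- For `m = 0` the right-hand side is `2` and the bound is trivial.
  rcases Nat.eq_zero_or_pos m with rfl | hm
  · have h1 : P.real {ω | ε ≤ |1 / ((0 : ℕ) : ℝ) * ∑ j ∈ Finset.range 0, Z j ω|} ≤ 1 :=
      measureReal_le_one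
    simpa using h1.trans (by norm_num)
  have hm' : (0 : ℝ) < m := by exact_mod_cast hm
  -- This `t` makes `t * ε - C * t ^ 2 ≥ t * ε / 2`.
  set t := min 1 (ε / (2 * C))
  have ht0 : 0 < t := lt_min one_pos (by positivity)
  have ht1 : |t| ≤ 1 := by
    rw [abs_of_pos ht0]
    exact min_le_left _ _
  have htC : C * t ≤ ε / 2 := by
    have : t ≤ ε / (2 * C) := min_le_right _ _
    rw [le_div_iff₀ (by positivity)] at this
    linarith
  have hrate : Real.exp (-(t * ε - C * t ^ 2) * m) ≤ Real.exp (-(t * ε / 2) * m) := by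
    rw [Real.exp_le_exp]
    refine mul_le_mul_of_nonneg_right ?_ hm'.le
    nlinarith
  have hup := (measureReal_le_sum_le_exp (ε := ε) hind hZ ht0.le (fun j => hint j t ht1)
    (fun j => hmgf j t ht1) m).trans hrate
  have hindneg : iIndepFun (fun j ω => -Z j ω) P :=
    hind.comp (fun _ x => -x) fun _ => measurable_neg
  have hneg : |(-t)| ≤ 1 := by rwa [abs_neg]
  have hlow := (measureReal_le_sum_le_exp (ε := ε) hindneg (fun j => (hZ j).neg) ht0.le
    (fun j => by simpa using hint j (-t) hneg)
    (fun j => by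
      have h := hmgf j (-t) hneg
      rw [neg_sq] at h
      exact (mgf_neg (X := Z j) (μ := P) (t := t)).le.trans h) m).trans hrate
  have hsub : {ω | ε ≤ |1 / (m : ℝ) * ∑ j ∈ Finset.range m, Z j ω|}
      ⊆ {ω | m * ε ≤ ∑ j ∈ Finset.range m, Z j ω}
        ∪ {ω | m * ε ≤ ∑ j ∈ Finset.range m, -Z j ω} := by
    intro ω hω
    simp only [mem_ofPred_eq, mem_union] at hω ⊢
    rw [abs_mul, abs_of_pos (one_div_pos.2 hm'), one_div, ← div_eq_inv_mul,
      le_div_iff₀ hm', mul_comm, le_abs] at hω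
    rwa [Finset.sum_neg_distrib]
  calc _ ≤ P.real ({ω | m * ε ≤ ∑ j ∈ Finset.range m, Z j ω}
        ∪ {ω | m * ε ≤ ∑ j ∈ Finset.range m, -Z j ω}) := measureReal_mono hsub
    _ ≤ _ := measureReal_union_le _ _
    _ ≤ _ := by linarith

end Chernoff

/-! ### Linear statistics of a Poisson process -/

section LinearStatistic

variable {S : Type*}

lemma sum_indicator_const (A : Set S) (c : ENNReal) (x : Finset S) :
    ∑ ξ ∈ x, A.indicator (fun _ => c) ξ = count A x * c := by
  classical
  simp only [indicator_apply, count]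
  rw [← Finset.sum_filter, Finset.sum_const, nsmul_eq_mul]

lemma sum_iSup_of_monotone {f : ℕ → S → ENNReal} (hf : Monotone f) (x : Finset S) :
    ∑ ξ ∈ x, ⨆ n, f n ξ = ⨆ n, ∑ ξ ∈ x, f n ξ :=
  ENNReal.finsetSum_iSup_of_monotone fun ξ _ _ hij => hf hij ξ

lemma toReal_sum_ofReal {g : S → ℝ} (hg0 : ∀ ξ, 0 ≤ g ξ) (x : Finset S) :
    (∑ ξ ∈ x, ENNReal.ofReal (g ξ)).toReal = ∑ ξ ∈ x, g ξ := by
  rw [ENNReal.toReal_sum fun _ _ => ENNReal.ofReal_ne_top]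
  exact Finset.sum_congr rfl fun ξ _ => ENNReal.toReal_ofReal (hg0 ξ)

lemma sum_le_mul_count_univ {g : S → ℝ} {c : ℝ} (hgc : ∀ ξ, g ξ ≤ c) (x : Finset S) :
    ∑ ξ ∈ x, g ξ ≤ c * count univ x := by
  calc _ ≤ ∑ _ξ ∈ x, c := Finset.sum_le_sum fun ξ _ => hgc ξ
    _ = _ := by simp [count, mul_comm]

variable [MeasurableSpace S] {Ω : Type*} [MeasurableSpace Ω]

lemma measurable_count_configSpace {A : Set S} (hA : MeasurableSet A) :
    Measurable[configSpace S] (count A) := by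
  rw [measurable_iff_comap_le]
  exact le_iSup (fun A : {A : Set S // MeasurableSet A} =>
    MeasurableSpace.comap (count A.1) ⊤) ⟨A, hA⟩

lemma measurable_sum_configSpace {f : S → ENNReal} (hf : Measurable f) :
    Measurable[configSpace S] fun x : Finset S => ∑ ξ ∈ x, f ξ := by
  let _ : MeasurableSpace (Finset S) := configSpace S
  refine Measurable.ennreal_induction
    (motive := fun f => Measurable fun x : Finset S => ∑ ξ ∈ x, f ξ)
    (fun c A hA => ?_) (fun f g _ _ _ hf hg => ?_) (fun f _ hmono h => ?_) hf
  · simp only [sum_indicator_const]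
    have h : Measurable fun n : ℕ => (n : ENNReal) * c := measurable_from_nat
    exact h.comp (measurable_count_configSpace hA)
  · simp only [Pi.add_apply, Finset.sum_add_distrib]
    exact hf.add hg
  · simp only [sum_iSup_of_monotone hmono]
    exact Measurable.iSup h

lemma measurable_sum_real_configSpace {g : S → ℝ} (hg : Measurable g) (hg0 : ∀ ξ, 0 ≤ g ξ) :
    Measurable[configSpace S] fun x : Finset S => ∑ ξ ∈ x, g ξ := by
  simp only [← toReal_sum_ofReal hg0]
  exact ENNReal.measurable_toReal.comp (measurable_sum_configSpace hg.ennreal_ofReal)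

variable {ν : Measure S} {lam : S → ℝ} {P : Measure Ω}

lemma IsPoissonProcess.measurable {X : Ω → Finset S} (hX : IsPoissonProcess ν lam P X) :
    @Measurable _ _ _ (configSpace S) X := by
  rw [measurable_iff_comap_le, MeasurableSpace.comap_iSup]
  refine iSup_le fun A => ?_
  rw [MeasurableSpace.comap_comp]
  exact (hX.measurable_count A.1 A.2).comap_le

/-- **Campbell's formula** for nonnegative functions. -/
lemma IsPoissonProcess.lintegral_sum {X : Ω → Finset S} (hX : IsPoissonProcess ν lam P X)
    (hlam : Integrable lam ν) (hlam0 : ∀ ζ, 0 ≤ lam ζ) {f : S → ENNReal} (hf : Measurable f) :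
    ∫⁻ ω, ∑ ξ ∈ X ω, f ξ ∂P = ∫⁻ ξ, f ξ ∂(ν.withDensity fun ξ => ENNReal.ofReal (lam ξ)) := by
  have hmeas : ∀ {f : S → ENNReal}, Measurable f → Measurable fun ω => ∑ ξ ∈ X ω, f ξ :=
    fun hf => (measurable_sum_configSpace hf).comp hX.measurable
  refine Measurable.ennreal_induction
    (motive := fun f => ∫⁻ ω, ∑ ξ ∈ X ω, f ξ ∂P
      = ∫⁻ ξ, f ξ ∂(ν.withDensity fun ξ => ENNReal.ofReal (lam ξ)))
    (fun c A hA => ?_) (fun f g _ hf hg ihf ihg => ?_) (fun f hf hmono ih => ?_) hf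
  · simp only [sum_indicator_const]
    have hcount : Measurable fun ω => (count A (X ω) : ENNReal) :=
      measurable_from_nat.comp (hX.measurable_count A hA)
    rw [lintegral_mul_const _ hcount,
      lintegral_indicator_const hA, withDensity_apply _ hA, mul_comm,
      ← ofReal_integral_eq_lintegral_ofReal hlam.integrableOn (ae_of_all _ hlam0)]
    have h := lintegral_map (μ := P) (f := fun n : ℕ => (n : ENNReal)) measurable_from_nat
      (hX.measurable_count A hA)
    rw [hX.law_count A hA, lintegral_natCast_poissonMeasure] at h
    rw [← h]
    rfl
  · simp only [Pi.add_apply, Finset.sum_add_distrib]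
    rw [lintegral_add_left (hmeas hf), lintegral_add_left hf, ihf, ihg]
  · simp only [sum_iSup_of_monotone hmono]
    rw [lintegral_iSup (fun n => hmeas (hf n)), lintegral_iSup hf hmono]
    · simp only [ih]
    · exact fun i j hij ω => Finset.sum_le_sum fun ξ _ => hmono hij ξ

lemma IsPoissonProcess.integrable_exp_mul_count {X : Ω → Finset S}
    (hX : IsPoissonProcess ν lam P X) (c : ℝ) :
    Integrable (fun ω => Real.exp (c * count univ (X ω))) P := by
  have h := integrable_exp_mul_poissonMeasure (∫ ζ in univ, lam ζ ∂ν).toNNReal c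
  rw [← hX.law_count univ MeasurableSet.univ] at h
  exact h.comp_measurable (hX.measurable_count univ MeasurableSet.univ)

lemma IsPoissonProcess.integral_exp_mul_count {X : Ω → Finset S}
    (hX : IsPoissonProcess ν lam P X) (c : ℝ) :
    ∫ ω, Real.exp (c * count univ (X ω)) ∂P
      = ∫ n : ℕ, Real.exp (c * n) ∂poissonMeasure (∫ ζ in univ, lam ζ ∂ν).toNNReal := by
  rw [← hX.law_count univ MeasurableSet.univ]
  exact (integral_map (hX.measurable_count univ MeasurableSet.univ).aemeasurable
    (f := fun n : ℕ => Real.exp (c * n)) (by fun_prop)).symm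

lemma IsPoissonProcess.integrable_sum [IsProbabilityMeasure P] {X : Ω → Finset S}
    (hX : IsPoissonProcess ν lam P X) {g : S → ℝ} {c : ℝ} (hg : Measurable g)
    (hg0 : ∀ ξ, 0 ≤ g ξ) (hgc : ∀ ξ, g ξ ≤ c) :
    Integrable (fun ω => ∑ ξ ∈ X ω, g ξ) P := by
  refine (hX.integrable_exp_mul_count c).mono'
    ((measurable_sum_real_configSpace hg hg0).comp hX.measurable).aestronglyMeasurable
    (ae_of_all _ fun ω => ?_)
  rw [Real.norm_of_nonneg (Finset.sum_nonneg fun ξ _ => hg0 ξ)]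
  linarith [sum_le_mul_count_univ hgc (X ω), Real.add_one_le_exp (c * count univ (X ω))]

lemma IsPoissonProcess.integral_sum {X : Ω → Finset S}
    (hX : IsPoissonProcess ν lam P X) (hlam : Integrable lam ν) (hlam0 : ∀ ζ, 0 ≤ lam ζ)
    {g : S → ℝ} (hg : Measurable g) (hg0 : ∀ ξ, 0 ≤ g ξ) :
    ∫ ω, ∑ ξ ∈ X ω, g ξ ∂P = ∫ ξ, g ξ * lam ξ ∂ν := by
  have hm := (measurable_sum_real_configSpace hg hg0).comp hX.measurable
  rw [integral_eq_lintegral_of_nonneg_ae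
      (ae_of_all _ fun ω => Finset.sum_nonneg fun ξ _ => hg0 ξ) hm.aestronglyMeasurable,
    integral_eq_lintegral_of_nonneg_ae (ae_of_all _ fun ξ => mul_nonneg (hg0 ξ) (hlam0 ξ))
      (hg.aestronglyMeasurable.mul hlam.aestronglyMeasurable)]
  simp only [ENNReal.ofReal_mul (hg0 _), ENNReal.ofReal_sum_of_nonneg fun ξ _ => hg0 ξ]
  rw [hX.lintegral_sum hlam hlam0 hg.ennreal_ofReal,
    lintegral_withDensity_eq_lintegral_mul₀ hlam.aemeasurable.ennreal_ofReal
      hg.ennreal_ofReal.aemeasurable]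
  simp only [Pi.mul_apply, mul_comm]

/-- Averages of a bounded linear statistic over independent Poisson processes concentrate
exponentially fast, at a rate that does not depend on the probability space nor on the processes
realizing the sample: only the law of the total number of points enters the exponential moments. -/
theorem exists_rate_average_sum.{u, v} {S : Type u} [MeasurableSpace S] {ν : Measure S}
    {lam : S → ℝ} (hlam : Integrable lam ν) (hlam0 : ∀ ζ, 0 ≤ lam ζ) {g : S → ℝ} {c ε : ℝ}
    (hg : Measurable g) (hg0 : ∀ ξ, 0 ≤ g ξ) (hgc : ∀ ξ, g ξ ≤ c) (hε : 0 < ε) :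
    ∃ δ > 0, ∀ (Ω : Type v) [MeasurableSpace Ω] (P : Measure Ω) [IsProbabilityMeasure P]
      (X : ℕ → Ω → Finset S), IsPoissonSample ν lam P X → ∀ m : ℕ,
      P.real {ω | ε ≤ |1 / (m : ℝ) * ∑ j ∈ Finset.range m,
        (∑ ξ ∈ X j ω, g ξ - ∫ ξ, g ξ * lam ξ ∂ν)|} ≤ 2 * Real.exp (-δ * m) := by
  set a := ∫ ξ, g ξ * lam ξ ∂ν with ha
  have ha0 : 0 ≤ a := integral_nonneg fun ξ => mul_nonneg (hg0 ξ) (hlam0 ξ)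
  set I := ∫ n : ℕ, Real.exp (2 * c * n) ∂poissonMeasure (∫ ζ in univ, lam ζ ∂ν).toNNReal
  have hIpos : 0 < I := integral_exp_pos (integrable_exp_mul_poissonMeasure _ _)
  set C := 2 * (Real.exp (2 * a) * I)
  have hCpos : 0 < C := by positivity
  refine ⟨min 1 (ε / (2 * C)) * ε / 2, by positivity, fun Ω _ P _ X hX m => ?_⟩
  have hmeas : ∀ j, Measurable fun ω => ∑ ξ ∈ X j ω, g ξ - a := fun j =>
    ((measurable_sum_real_configSpace hg hg0).comp (hX.poisson j).measurable).sub_const a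
  have hind : iIndepFun (fun j ω => ∑ ξ ∈ X j ω, g ξ - a) P :=
    hX.indep.comp (fun _ x => ∑ ξ ∈ x, g ξ - a) fun _ =>
      (measurable_id.sub_const a).comp (measurable_sum_real_configSpace hg hg0)
  have hle : ∀ j ω, |∑ ξ ∈ X j ω, g ξ - a| ≤ a + c * count univ (X j ω) := fun j ω => by
    have h0 : 0 ≤ ∑ ξ ∈ X j ω, g ξ := Finset.sum_nonneg fun ξ _ => hg0 ξ
    have h1 := sum_le_mul_count_univ hgc (X j ω)
    rw [abs_le]
    constructor <;> linarith
  have hexp : ∀ j, (fun ω => Real.exp (2 * (a + c * count univ (X j ω))))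
      = fun ω => Real.exp (2 * a) * Real.exp (2 * c * count univ (X j ω)) := fun j => by
    ext ω
    rw [← Real.exp_add]
    ring_nf
  have hW : ∀ j, Integrable (fun ω => Real.exp (2 * (a + c * count univ (X j ω)))) P := fun j => by
    rw [hexp]
    exact ((hX.poisson j).integrable_exp_mul_count _).const_mul _
  have hWI : ∀ j, 2 * (∫ ω, Real.exp (2 * (a + c * count univ (X j ω))) ∂P) = C := fun j => by
    rw [hexp, integral_const_mul, (hX.poisson j).integral_exp_mul_count]
  refine measureReal_le_abs_average_le_exp hind hmeas hCpos hε
    (fun j t ht => integrable_exp_mul_of_abs_le (hmeas j) (hle j) (hW j) ht)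
    (fun j t ht => ?_) m
  have hsum := (hX.poisson j).integrable_sum hg hg0 hgc
  rw [← hWI j]
  refine mgf_le_exp_mul_sq (hmeas j) (hle j) (hW j) (hsum.sub (integrable_const a)) ?_ ht
  rw [integral_sub hsum (integrable_const a), (hX.poisson j).integral_sum hlam hlam0 hg hg0]
  simp [ha]

end LinearStatistic

/-! ### The kernel as an approximate identity -/

section Kernel

variable {k : ℝ → ℝ}

lemma exists_kernel_bound {D : ℝ} (hk_cont : ContinuousOn k (Icc 0 D))
    (hk_supp : ∀ x, D < x → k x = 0) : ∃ M, ∀ x, 0 ≤ x → k x ≤ M := by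
  obtain ⟨M, hM⟩ := isCompact_Icc.exists_bound_of_continuousOn hk_cont
  refine ⟨max M 0, fun x hx => ?_⟩
  rcases le_or_gt x D with h | h
  · exact ((le_abs_self _).trans (hM x ⟨hx, h⟩)).trans (le_max_left _ _)
  · rw [hk_supp x h]
    exact le_max_right _ _

variable {S : Type*} [MetricSpace S] [MeasurableSpace S]

/-- The normalized kernel weight `K_σ(ζ)⁻¹ σ^{-d} k(ρ(ζ, ξ) / σ)`, so that the kernel estimator
of the intensity is the linear statistic `x ↦ ∑ ξ ∈ x, kernelWeight ν k d σ ζ ξ`. -/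
noncomputable def kernelWeight (ν : Measure S) (k : ℝ → ℝ) (d σ : ℝ) (ζ ξ : S) : ℝ :=
  1 / kernelMass ν k d σ ζ * (1 / σ ^ d * k (dist ζ ξ / σ))

variable {ν : Measure S} {d σ : ℝ} {ζ : S}

lemma intensityEstimator_eq_sum (x : Finset S) :
    intensityEstimator ν k d σ x ζ = ∑ ξ ∈ x, kernelWeight ν k d σ ζ ξ := by
  simp only [intensityEstimator, kernelWeight, Finset.mul_sum]

lemma averagedEstimator_sub {m : ℕ} (hm : m ≠ 0) (x : ℕ → Finset S) (a : ℝ) :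
    averagedEstimator ν k d σ m x ζ - a = 1 / (m : ℝ) * ∑ j ∈ Finset.range m,
      (∑ ξ ∈ x j, kernelWeight ν k d σ ζ ξ - a) := by
  have hm' : (m : ℝ) ≠ 0 := by exact_mod_cast hm
  simp only [averagedEstimator, intensityEstimator_eq_sum, Finset.sum_sub_distrib,
    Finset.sum_const, Finset.card_range, nsmul_eq_mul]
  field_simp

lemma kernelWeight_nonneg (hk_nonneg : ∀ x, 0 ≤ k x) (hσ : 0 < σ)
    (hK : 0 < kernelMass ν k d σ ζ) (ξ : S) : 0 ≤ kernelWeight ν k d σ ζ ξ := by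
  have := hk_nonneg (dist ζ ξ / σ)
  rw [kernelWeight]
  positivity

lemma exists_kernelWeight_bound {D : ℝ} (hk_cont : ContinuousOn k (Icc 0 D))
    (hk_supp : ∀ x, D < x → k x = 0) (hσ : 0 < σ) (hK : 0 < kernelMass ν k d σ ζ) :
    ∃ c, ∀ ξ, kernelWeight ν k d σ ζ ξ ≤ c := by
  obtain ⟨M, hM⟩ := exists_kernel_bound hk_cont hk_supp
  refine ⟨1 / kernelMass ν k d σ ζ * (1 / σ ^ d * M), fun ξ => ?_⟩
  have := hM (dist ζ ξ / σ) (by positivity)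
  rw [kernelWeight]
  gcongr

lemma integral_kernelWeight (hK : 0 < kernelMass ν k d σ ζ) :
    ∫ ξ, kernelWeight ν k d σ ζ ξ ∂ν = 1 := by
  simp only [kernelWeight]
  rw [integral_const_mul]
  change 1 / kernelMass ν k d σ ζ * kernelMass ν k d σ ζ = 1
  field_simp

variable [BorelSpace S]

/-- The kernel `k` may jump at the edge `D` of its support and is arbitrary on negative
arguments; only its values at nonnegative arguments matter, where it is the extension by zero of a
continuous function on a closed interval. -/
lemma measurable_kernel_dist {D : ℝ}
    (hk_cont : ContinuousOn k (Icc 0 D)) (hk_supp : ∀ x, D < x → k x = 0) (hσ : 0 < σ)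
    (ζ : S) : Measurable fun ξ => k (dist ζ ξ / σ) := by
  classical
  have h1 : Measurable ((Icc 0 D).piecewise k fun _ => 0) :=
    hk_cont.measurable_piecewise continuousOn_const measurableSet_Icc
  have h2 : (fun ξ => k (dist ζ ξ / σ))
      = fun ξ => (Icc 0 D).piecewise k (fun _ => 0) (dist ζ ξ / σ) := by
    ext ξ
    by_cases h : dist ζ ξ / σ ∈ Icc 0 D
    · rw [piecewise_eq_of_mem _ _ _ h]
    · rw [piecewise_eq_of_notMem _ _ _ h]
      exact hk_supp _ (not_le.1 fun h' => h ⟨by positivity, h'⟩)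
  rw [h2]
  have hd : Measurable fun ξ => dist ζ ξ / σ := by fun_prop
  exact h1.comp hd

lemma integrable_kernel [IsFiniteMeasure ν] {D : ℝ} (hk_nonneg : ∀ x, 0 ≤ k x)
    (hk_cont : ContinuousOn k (Icc 0 D)) (hk_supp : ∀ x, D < x → k x = 0) (hσ : 0 < σ) :
    Integrable (fun ξ => 1 / σ ^ d * k (dist ζ ξ / σ)) ν := by
  obtain ⟨M, hM⟩ := exists_kernel_bound hk_cont hk_supp
  refine Integrable.const_mul ((integrable_const M).mono'
    (measurable_kernel_dist hk_cont hk_supp hσ ζ).aestronglyMeasurable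
    (ae_of_all _ fun ξ => ?_)) _
  rw [Real.norm_of_nonneg (hk_nonneg _)]
  exact hM _ (by positivity)

/-- At a point of the topological support of `ν` the normalization does not vanish. -/
lemma kernelMass_pos [CompactSpace S] [IsFiniteMeasure ν] (hk_nonneg : ∀ x, 0 ≤ k x)
    (hk_cont : ContinuousOn k (Icc 0 (Metric.diam (univ : Set S))))
    (hk_supp : ∀ x, Metric.diam (univ : Set S) < x → k x = 0)
    (hk_pos : ∀ x ∈ Icc 0 (Metric.diam (univ : Set S)), 0 < k x) (hσ : 0 < σ)
    (hζ : ζ ∈ ν.support) : 0 < kernelMass ν k d σ ζ := by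
  have hσd : 0 < 1 / σ ^ d := one_div_pos.2 (Real.rpow_pos_of_pos hσ d)
  rw [kernelMass, integral_pos_iff_support_of_nonneg
    (fun ξ => mul_nonneg hσd.le (hk_nonneg _)) (integrable_kernel hk_nonneg hk_cont hk_supp hσ)]
  have hdiam : ∀ ξ, dist ζ ξ ≤ Metric.diam (univ : Set S) := fun ξ =>
    Metric.dist_le_diam_of_mem isCompact_univ.isBounded (mem_univ _) (mem_univ _)
  -- For `diam S = 0` the closed ball of radius `0` is still a neighbourhood, since `S` is a point.
  have hnhds : {ξ | dist ζ ξ / σ ≤ Metric.diam (univ : Set S)} ∈ 𝓝 ζ := by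
    rcases (Metric.diam_nonneg (s := (univ : Set S))).eq_or_lt with h0 | h0
    · refine mem_of_superset univ_mem fun ξ _ => ?_
      have : dist ζ ξ = 0 := le_antisymm (h0 ▸ hdiam ξ) dist_nonneg
      simp [this, Metric.diam_nonneg]
    · refine mem_of_superset (Metric.ball_mem_nhds ζ (mul_pos h0 hσ)) fun ξ hξ => ?_
      rw [Metric.mem_ball, dist_comm] at hξ
      exact (div_le_iff₀ hσ).2 hξ.le
  refine ((Measure.mem_support_iff_forall ζ).1 hζ _ hnhds).trans_le (measure_mono fun ξ hξ => ?_)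
  exact (mul_pos hσd (hk_pos _ ⟨by positivity, hξ⟩)).ne'

lemma measurable_kernelWeight {D : ℝ} (hk_cont : ContinuousOn k (Icc 0 D))
    (hk_supp : ∀ x, D < x → k x = 0) (hσ : 0 < σ) : Measurable (kernelWeight ν k d σ ζ) :=
  ((measurable_kernel_dist hk_cont hk_supp hσ ζ).const_mul _).const_mul _

lemma integrable_kernelWeight [IsFiniteMeasure ν] {D : ℝ} (hk_nonneg : ∀ x, 0 ≤ k x)
    (hk_cont : ContinuousOn k (Icc 0 D)) (hk_supp : ∀ x, D < x → k x = 0) (hσ : 0 < σ) :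
    Integrable (kernelWeight ν k d σ ζ) ν :=
  (integrable_kernel hk_nonneg hk_cont hk_supp hσ).const_mul _

/-- The kernel weights form an approximate identity, so the estimator is asymptotically
unbiased. -/
lemma tendsto_integral_kernelWeight_mul [IsFiniteMeasure ν] {D : ℝ} {lam : S → ℝ}
    (hlam : Integrable lam ν) (hlam_cont : Continuous lam) (hk_nonneg : ∀ x, 0 ≤ k x)
    (hk_cont : ContinuousOn k (Icc 0 D)) (hk_supp : ∀ x, D < x → k x = 0)
    {s : ℕ → ℝ} (hs : ∀ n, 0 < s n) (hs0 : Tendsto s atTop (𝓝 0))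
    (hK : ∀ n, 0 < kernelMass ν k d (s n) ζ) :
    Tendsto (fun n => ∫ ξ, kernelWeight ν k d (s n) ζ ξ * lam ξ ∂ν) atTop (𝓝 (lam ζ)) := by
  rw [Metric.tendsto_atTop']
  intro η hη
  obtain ⟨r, hr, hlr⟩ := Metric.continuous_iff.1 hlam_cont ζ (η / 2) (half_pos hη)
  have hsD : Tendsto (fun n => D * s n) atTop (𝓝 0) := by simpa using hs0.const_mul D
  obtain ⟨n₀, hn₀⟩ := eventually_atTop.1 (hsD.eventually_lt_const hr)
  refine ⟨n₀, fun n hn => ?_⟩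
  have hw := integrable_kernelWeight (ν := ν) (d := d) (ζ := ζ) hk_nonneg hk_cont hk_supp (hs n)
  have hw0 := kernelWeight_nonneg (d := d) hk_nonneg (hs n) (hK n)
  obtain ⟨c, hc⟩ := exists_kernelWeight_bound hk_cont hk_supp (hs n) (hK n)
  have hwl : Integrable (fun ξ => kernelWeight ν k d (s n) ζ ξ * lam ξ) ν :=
    hlam.bdd_mul hw.aestronglyMeasurable (c := c)
      (ae_of_all _ fun ξ => by rw [Real.norm_of_nonneg (hw0 ξ)]; exact hc ξ)
  have hdiff : ∫ ξ, kernelWeight ν k d (s n) ζ ξ * lam ξ ∂ν - lam ζ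
      = ∫ ξ, kernelWeight ν k d (s n) ζ ξ * (lam ξ - lam ζ) ∂ν := by
    simp only [mul_sub]
    rw [integral_sub hwl (hw.mul_const _), integral_mul_const, integral_kernelWeight (hK n),
      one_mul]
  rw [Real.dist_eq, hdiff]
  have hle : ‖∫ ξ, kernelWeight ν k d (s n) ζ ξ * (lam ξ - lam ζ) ∂ν‖
      ≤ ∫ ξ, kernelWeight ν k d (s n) ζ ξ * (η / 2) ∂ν := by
    refine norm_integral_le_of_norm_le (hw.mul_const _) (ae_of_all _ fun ξ => ?_)
    rw [norm_mul, Real.norm_of_nonneg (hw0 ξ)]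
    rcases lt_or_ge (dist ξ ζ) r with h | h
    · exact mul_le_mul_of_nonneg_left (hlr ξ h).le (hw0 ξ)
    · have h0 : kernelWeight ν k d (s n) ζ ξ = 0 := by
        rw [kernelWeight, hk_supp, mul_zero, mul_zero]
        rw [lt_div_iff₀ (hs n), dist_comm]
        exact (hn₀ n hn.le).trans_le h
      simp [h0]
  rw [integral_mul_const, integral_kernelWeight (hK n), one_mul] at hle
  exact hle.trans_lt (half_lt_self hη)

end Kernel

/-! ### Choice of the bandwidths -/

section Bandwidth

/-- Diagonal extraction: a property that holds eventually in `m` for each fixed `n` holds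
eventually along some `n = N m → ∞`. -/
lemma exists_tendsto_atTop_eventually {Q : ℕ → ℕ → Prop} (hQ : ∀ n, ∀ᶠ m in atTop, Q n m) :
    ∃ N : ℕ → ℕ, Tendsto N atTop atTop ∧ ∀ᶠ m in atTop, Q (N m) m := by
  classical
  simp only [eventually_atTop] at hQ
  choose M hM using hQ
  -- `N m` is the largest `n ≤ m` whose threshold `M n` has been passed.
  refine ⟨fun m => Nat.findGreatest (fun n => M n ≤ m) m, tendsto_atTop.2 fun n => ?_, ?_⟩
  · filter_upwards [eventually_ge_atTop (max n (M n))] with m hm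
    exact Nat.le_findGreatest ((le_max_left _ _).trans hm) ((le_max_right _ _).trans hm)
  · filter_upwards [eventually_ge_atTop (M 0)] with m hm
    exact hM _ _ (Nat.findGreatest_spec (P := fun n => M n ≤ m) (Nat.zero_le m) hm)

lemma eventually_two_mul_exp_le {δ : ℝ} (hδ : 0 < δ) :
    ∀ᶠ m : ℕ in atTop, 2 * Real.exp (-δ * m) ≤ 1 / (m : ℝ) ^ 2 := by
  have h := ((tendsto_rpow_mul_exp_neg_mul_atTop_nhds_zero 2 δ hδ).comp
    tendsto_natCast_atTop_atTop).eventually_lt_const (show (0 : ℝ) < 1 / 2 by norm_num)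
  filter_upwards [h, eventually_gt_atTop 0] with m hm hm0
  have hm' : (0 : ℝ) < m := by exact_mod_cast hm0
  rw [le_div_iff₀ (by positivity)]
  simp only [Function.comp_apply, Real.rpow_two] at hm
  linarith

lemma ae_eventually_lt_of_measureReal_le {Ω : Type*} [MeasurableSpace Ω] {P : Measure Ω}
    [IsProbabilityMeasure P] {f : ℕ → Ω → ℝ} {ε : ℕ → ℝ}
    (h : ∀ᶠ m in atTop, P.real {ω | ε m ≤ f m ω} ≤ 1 / (m : ℝ) ^ 2) :
    ∀ᵐ ω ∂P, ∀ᶠ m in atTop, f m ω < ε m := by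
  have hsum : Summable fun m => P.real {ω | ε m ≤ f m ω} := by
    refine summable_of_isBigO_nat (Real.summable_one_div_nat_pow.2 one_lt_two)
      (Asymptotics.IsBigO.of_bound 1 ?_)
    filter_upwards [h] with m hm
    rw [Real.norm_of_nonneg measureReal_nonneg, one_mul]
    exact hm.trans (le_abs_self _)
  have hne : ∑' m, P {ω | ε m ≤ f m ω} ≠ ⊤ := by
    have h := hsum.tsum_ofReal_ne_top
    simp only [ofReal_measureReal (measure_ne_top P _)] at h
    exact h
  filter_upwards [ae_eventually_notMem hne] with ω hω
  filter_upwards [hω] with m hm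
  simpa using hm

/-- At every point of the topological support of `ν` there are deterministic bandwidths along which
the averaged estimator is strongly consistent. -/
theorem exists_bandwidth.{u, v} {S : Type u} [MetricSpace S] [CompactSpace S] [MeasurableSpace S]
    [BorelSpace S] {ν : Measure S} [IsFiniteMeasure ν] {lam : S → ℝ} (hlam : Integrable lam ν)
    (hlam_cont : Continuous lam) (hlam0 : ∀ ζ, 0 ≤ lam ζ) (d : ℝ) {k : ℝ → ℝ}
    (hk_nonneg : ∀ x, 0 ≤ k x) (hk_cont : ContinuousOn k (Icc 0 (Metric.diam (univ : Set S))))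
    (hk_supp : ∀ x, Metric.diam (univ : Set S) < x → k x = 0)
    (hk_pos : ∀ x ∈ Icc 0 (Metric.diam (univ : Set S)), 0 < k x) {ζ : S} (hζ : ζ ∈ ν.support) :
    ∃ σ : ℕ → ℝ, (∀ m, 0 < σ m) ∧ Tendsto σ atTop (𝓝 0) ∧
      ∀ (Ω : Type v) [MeasurableSpace Ω] (P : Measure Ω) [IsProbabilityMeasure P]
        (X : ℕ → Ω → Finset S), IsPoissonSample ν lam P X →
        ∀ᵐ ω ∂P, Tendsto
          (fun m : ℕ => |averagedEstimator ν k d (σ m) m (fun j => X j ω) ζ - lam ζ|)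
          atTop (𝓝 0) := by
  set s : ℕ → ℝ := fun n => 1 / ((n : ℝ) + 1)
  have hs : ∀ n, 0 < s n := fun n => Nat.one_div_pos_of_nat
  have hs0 : Tendsto s atTop (𝓝 0) := tendsto_one_div_add_atTop_nhds_zero_nat
  have hK : ∀ n, 0 < kernelMass ν k d (s n) ζ := fun n =>
    kernelMass_pos hk_nonneg hk_cont hk_supp hk_pos (hs n) hζ
  set a : ℕ → ℝ := fun n => ∫ ξ, kernelWeight ν k d (s n) ζ ξ * lam ξ ∂ν
  have ha : Tendsto a atTop (𝓝 (lam ζ)) :=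
    tendsto_integral_kernelWeight_mul hlam hlam_cont hk_nonneg hk_cont hk_supp hs hs0 hK
  choose c hc using fun n => exists_kernelWeight_bound hk_cont hk_supp (hs n) (hK n)
  have hrate := fun n => exists_rate_average_sum.{u, v} hlam hlam0
    (measurable_kernelWeight hk_cont hk_supp (hs n))
    (kernelWeight_nonneg hk_nonneg (hs n) (hK n)) (hc n) (hs n)
  choose δ hδ hrate using hrate
  obtain ⟨N, hN, hNm⟩ := exists_tendsto_atTop_eventually fun n => eventually_two_mul_exp_le (hδ n)
  refine ⟨fun m => s (N m), fun m => hs _, hs0.comp hN, fun Ω _ P _ X hX => ?_⟩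
  have hBC : ∀ᵐ ω ∂P, ∀ᶠ m : ℕ in atTop, |1 / (m : ℝ) * ∑ j ∈ Finset.range m,
      (∑ ξ ∈ X j ω, kernelWeight ν k d (s (N m)) ζ ξ - a (N m))| < s (N m) :=
    ae_eventually_lt_of_measureReal_le (hNm.mono fun m hm => (hrate (N m) Ω P X hX m).trans hm)
  filter_upwards [hBC] with ω hω
  have h0 : Tendsto (fun m => averagedEstimator ν k d (s (N m)) m (fun j => X j ω) ζ - a (N m))
      atTop (𝓝 0) := by
    refine squeeze_zero_norm' ?_ (hs0.comp hN)
    filter_upwards [hω, eventually_ne_atTop 0] with m hm hm0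
    rw [averagedEstimator_sub hm0]
    exact hm.le
  have h1 := (h0.add ((ha.comp hN).sub_const (lam ζ))).abs
  simpa using h1

end Bandwidth

end PoissonIntensity

theorem theorem1 {S : Type*} [MetricSpace S] [CompactSpace S] [MeasurableSpace S] [BorelSpace S]
    (ν : Measure S) (lam : S → ℝ) (hlam_int : Integrable lam ν) (hlam_cont : Continuous lam)
    (lam0 : ℝ) (hlam0 : 0 < lam0) (hlam_ge : ∀ ζ, lam0 ≤ lam ζ)
    (d : ℝ) (k : ℝ → ℝ) (hk_symm : ∀ x, k (-x) = k x) (hk_nonneg : ∀ x, 0 ≤ k x)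
    (hk_cont : ContinuousOn k (Set.Icc 0 (Metric.diam (Set.univ : Set S))))
    (hk_supp : ∀ x, Metric.diam (Set.univ : Set S) < x → k x = 0)
    (k0 : ℝ) (hk0 : 0 < k0)
    (hk_gt : ∀ x ∈ Set.Icc 0 (Metric.diam (Set.univ : Set S)), k0 < k x) :
    ∀ᵐ ζ ∂ν, ∃ σ : ℕ → ℝ, (∀ m, 0 < σ m) ∧ Tendsto σ atTop (𝓝 0) ∧
      ∀ (Ω : Type*) [MeasurableSpace Ω] (P : Measure Ω) [IsProbabilityMeasure P]
        (X : ℕ → Ω → Finset S), PoissonIntensity.IsPoissonSample ν lam P X →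
        ∀ᵐ ω ∂P, Tendsto
          (fun m : ℕ =>
            |PoissonIntensity.averagedEstimator ν k d (σ m) m (fun j => X j ω) ζ - lam ζ|)
          atTop (𝓝 0) := by
  have hfin : IsFiniteMeasure ν := by
    have hc : Integrable (fun _ : S => lam0) ν := by
      refine hlam_int.mono' aestronglyMeasurable_const (ae_of_all _ fun ζ => ?_)
      rw [Real.norm_of_nonneg hlam0.le]
      exact hlam_ge ζ
    exact (integrable_const_iff.1 hc).resolve_left hlam0.ne'
  filter_upwards [ν.support_mem_ae] with ζ hζ
  exact PoissonIntensity.exists_bandwidth hlam_int hlam_cont (fun ξ => hlam0.le.trans (hlam_ge ξ))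
    d hk_nonneg hk_cont hk_supp (fun x hx => hk0.trans (hk_gt x hx)) hζ
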